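/- Let $f\colon\{0,1\}^*\rightharpoonup\{0,1\}$ be a partial function that is monotone, i.e. $f(x)\le f(y)$ whenever $x\le y$ coordinatewise, $|x|=|y|$, and both values are defined. Suppose that $U=f^{-1}(0)$ and $V=f^{-1}(1)$ are in NP. For $n\ge 1$ let $f_n$ be the restriction of $f$ to $\{0,1\}^n$. A protocol of degree 2 with equality is a finite directed acyclic graph with exactly one vertex $v_0$ of in-degree zero (the source), in which every vertex has out-degree at most 2, together with sets $F_v\subseteq\{0,1\}^n\times\{0,1\}^n$ for the vertices $v$ such that (i) for each $v$ there are functions $q_v,r_v\colon\{0,1\}^n\to\mathbb{R}$ with $(x,y)\in F_v\Leftrightarrow q_v(x)=r_v(y)$ for all $x,y$, and (ii) for each sink $\ell$ there is an index $i$ with $(x,y)\in F_\ell\Leftrightarrow x_i=0\wedge y_i=1$ for all $x,y$. It solves $f_n$ if for all $x\in f_n^{-1}(0)$ and $y\in f_n^{-1}(1)$ we have $(x,y)\in F_{v_0}$, and whenever $v$ is not a sink and $(x,y)\in F_v$, some child $u$ of $v$ has $(x,y)\in F_u$. Its size is the number of its vertices. R(LIN) works with clauses that are finite sets of linear polynomials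 over $\mathbb{F}_2$, read as disjunctions. A refutation of a CNF formula starts from its clauses, in which each literal $\neg x_i$ is replaced by $1+x_i$, and derives the empty clause by the rules: from $C\cup\{0\}$ infer $C$; from $C\cup\{g\}$ and $D\cup\{h\}$ infer $C\cup D\cup\{g+h+1\}$. It is a sequence of clauses (dag-like), and its lines are the members of the sequence, initial clauses included. Then there are CNF formulas $\alpha^f_n$ ($n\ge 1$) of size $n^{O(1)}$ (at most $c\,n^k$ for constants $c,k$ depending only on $f$) such that for every $n\ge 1$ a protocol of degree 2 with equality solving $f_n$ exists, $\alpha^f_n$ has an R(LIN)-refutation, and every R(LIN)-refutation of $\alpha^f_n$ has at least $s(n)$ lines, where $s(n)$ is the minimum size of a protocol of degree 2 with equality solving $f_n$. -/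

import Mathlib

namespace RLin

/-! ### Nondeterministic Turing machines and NP -/

/-- A nondeterministic Turing machine with one two-way infinite tape. The alphabet `Symbol`
contains the blank `encode none` and the two input symbols `encode (some b)`. -/
structure NTM where
  State : Type
  Symbol : Type
  finState : Finite State
  finSymbol : Finite Symbol
  encode : Option Bool ↪ Symbol
  start : State
  accept : State
  trans : State → Symbol → Set (State × Symbol × Turing.Dir)

namespace NTM

/-- A configuration: the state, the position of the head, the content of the tape. -/
structure Cfg (M : NTM) where
  state : M.State
  pos : ℤ
  tape : ℤ → M.Symbol

/-- The initial configuration: the word `w` stands in the cells `0, …, |w| - 1`, all other cells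
are blank, and the head is on cell `0`. -/
def init (M : NTM) (w : List Bool) : M.Cfg where
  state := M.start
  pos := 0
  tape := fun i => M.encode (if 0 ≤ i then w[i.toNat]? else none)

/-- `M.Step c c'`: the machine can pass from `c` to `c'` in one step. -/
def Step (M : NTM) (c c' : M.Cfg) : Prop :=
  ∃ (q : M.State) (a : M.Symbol) (dir : Turing.Dir),
    (q, a, dir) ∈ M.trans c.state (c.tape c.pos) ∧
    c'.state = q ∧
    c'.tape = Function.update c.tape c.pos a ∧
    c'.pos = (match dir with
      | Turing.Dir.left => c.pos - 1
      | Turing.Dir.right => c.pos + 1)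

/-- Some computation of `M` on input `w` reaches the accepting state in at most `T` steps. -/
def AcceptsWithin (M : NTM) (w : List Bool) (T : ℕ) : Prop :=
  ∃ (t : ℕ) (c : ℕ → M.Cfg), t ≤ T ∧ c 0 = M.init w ∧
    (∀ i < t, M.Step (c i) (c (i + 1))) ∧ (c t).state = M.accept

end NTM

/-- The language `L` belongs to NP: some nondeterministic Turing machine accepts exactly the words
of `L`, and it does so in polynomial time. -/
def IsNP (L : Set (List Bool)) : Prop :=
  ∃ (M : NTM) (p : Polynomial ℕ), ∀ w : List Bool, w ∈ L ↔ M.AcceptsWithin w (p.eval w.length)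

/-! ### Partial monotone functions -/

/-- The restriction of a partial function on binary words to the words of length `n`. -/
def restrict (f : List Bool →. Bool) (n : ℕ) : (Fin n → Bool) →. Bool :=
  fun x => f (List.ofFn x)

/-- A partial Boolean function of `n` variables is monotone if it is so on its domain. -/
def IsMonotone {n : ℕ} (f : (Fin n → Bool) →. Bool) : Prop :=
  ∀ x y : Fin n → Bool, x ≤ y → ∀ a ∈ f x, ∀ b ∈ f y, a ≤ b

/-! ### Protocols -/

/-- A protocol of degree `d` with feasibility relation `F`, on a finite directed acyclic graph;
`children v` is the set of heads of the edges that leave `v`. -/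
structure Protocol (n d : ℕ) where
  V : Type
  fintypeV : Fintype V
  children : V → Finset V
  acyclic : ∀ v, ¬ Relation.TransGen (fun u w => w ∈ children u) v v
  source : V
  eq_source_iff : ∀ v, v = source ↔ ∀ u, v ∉ children u
  degree_le : ∀ v, (children v).card ≤ d
  F : (Fin n → Bool) → (Fin n → Bool) → V → Prop
  sink : ∀ v, children v = ∅ → ∃ i : Fin n, ∀ x y, F x y v ↔ (x i = false ∧ y i = true)

namespace Protocol

/-- The size of a protocol: the number of vertices. -/
def size {n d : ℕ} (P : Protocol n d) : ℕ :=
  @Fintype.card P.V P.fintypeV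

/-- The protocol solves the monotone Karchmer–Wigderson game for `f`. -/
def Solves {n d : ℕ} (P : Protocol n d) (f : (Fin n → Bool) →. Bool) : Prop :=
  ∀ x y : Fin n → Bool, false ∈ f x → true ∈ f y →
    P.F x y P.source ∧
    ∀ v, (P.children v).Nonempty → P.F x y v → ∃ u ∈ P.children v, P.F x y u

/-- The protocol is a protocol with equality. -/
def WithEquality {n d : ℕ} (P : Protocol n d) : Prop :=
  ∀ v, ∃ q r : (Fin n → Bool) → ℝ, ∀ x y, P.F x y v ↔ q x = r y

end Protocol

/-- The sizes of the protocols of degree 2 with equality that solve `f`. -/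
def equalityProtocolSizes {n : ℕ} (f : (Fin n → Bool) →. Bool) : Set ℕ :=
  {s | ∃ P : Protocol n 2, P.WithEquality ∧ P.Solves f ∧ P.size = s}

/-! ### CNF formulas and the proof system R(LIN) -/

/-- CNF formulas in the variables `x₀, x₁, …`, as finite sets of clauses; a clause is a finite set
of literals, where `(i, true)` is the literal `xᵢ` and `(i, false)` is the literal `¬xᵢ`. -/
abbrev CNF : Type := Finset (Finset (ℕ × Bool))

/-- The size of a CNF formula: the number of occurrences of literals plus the number of clauses. -/
def CNF.size (φ : CNF) : ℕ :=
  ∑ C ∈ φ, (C.card + 1)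

/-- A clause of R(LIN): a finite set of polynomials over `𝔽₂`, read as their disjunction. -/
abbrev LinClause : Type := Finset (MvPolynomial ℕ (ZMod 2))

/-- The linear polynomial of a literal: `xᵢ` for `xᵢ`, and `1 + xᵢ` for `¬xᵢ`. -/
noncomputable def literalPoly (l : ℕ × Bool) : MvPolynomial ℕ (ZMod 2) :=
  if l.2 then MvPolynomial.X l.1 else 1 + MvPolynomial.X l.1

/-- The R(LIN)-clauses of a CNF formula. -/
noncomputable def linClauses (φ : CNF) : Finset LinClause :=
  φ.image fun C => C.image literalPoly

/-- The contraction rule: from `C, 0` infer `C`. -/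
def Contraction (A C : LinClause) : Prop :=
  A = insert 0 C

/-- The addition rule: from `C, g` and `D, h` infer `C, D, g + h + 1`. -/
def Addition (A B E : LinClause) : Prop :=
  ∃ (C D : LinClause) (g h : MvPolynomial ℕ (ZMod 2)),
    A = insert g C ∧ B = insert h D ∧ E = insert (g + h + 1) (C ∪ D)

/-- An R(LIN)-refutation of `φ`: a sequence of `len + 1` clauses of linear polynomials that ends
in the empty clause, each of which is a clause of `φ` or follows from earlier ones by a rule. -/
structure Refutation (φ : CNF) where
  len : ℕ
  line : Fin (len + 1) → LinClause
  linear : ∀ j, ∀ f ∈ line j, f.totalDegree ≤ 1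
  derived : ∀ j, line j ∈ linClauses φ ∨
    (∃ i, i < j ∧ Contraction (line i) (line j)) ∨
    (∃ i k, i < j ∧ k < j ∧ Addition (line i) (line k) (line j))
  last_empty : line (Fin.last len) = ∅

/-- The number of lines of a refutation. -/
def Refutation.numLines {φ : CNF} (π : Refutation φ) : ℕ :=
  π.len + 1

/-- The numbers of lines of the R(LIN)-refutations of `φ`. -/
def refutationLengths (φ : CNF) : Set ℕ :=
  {m | ∃ π : Refutation φ, π.numLines = m}

end RLin

/-!
Nondeterministic machines for `U` and `V` give, for words of length `n`, polynomial-size formulas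
`φ(x, z)` and `ψ(y, w)` that define `fₙ⁻¹(0)` and `fₙ⁻¹(1)` by existential quantification over `z`
and `w`. Monotonicity makes `α = φ(x, z) ∧ ψ(y, w) ∧ ⋀ᵢ (yᵢ → xᵢ)` unsatisfiable, hence refutable.

Read from the empty clause upwards, a refutation of `α` is a protocol. Choose for each `x` and `y`
witnesses `z` and `w`, and let `F_v` consist of the pairs `(x, y)` for which the assignment
`(x, z, y, w)` falsifies the line `v`: a falsified conclusion has a falsified premise, and the only
initial clauses that can be falsified are the `yᵢ → xᵢ`. The assignment is a sum `a(x) + b(y)` over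
`𝔽₂`, and a linear polynomial splits additively along it, so falsity of a whole clause says that a
vector computed from `x` equals a vector computed from `y`. The finitely many possible vectors are
coded by real numbers.
-/

namespace RLin

/-! ### CNF formulas -/

namespace CNF

/-- The assignment `z` satisfies the formula `φ`. -/
def Satisfies (φ : CNF) (z : ℕ → Bool) : Prop :=
  ∀ C ∈ φ, ∃ l ∈ C, z l.1 = l.2

theorem satisfies_union {φ ψ : CNF} {z : ℕ → Bool} :
    Satisfies (φ ∪ ψ) z ↔ φ.Satisfies z ∧ ψ.Satisfies z :=
  Finset.forall_mem_union

theorem satisfies_biUnion {ι : Type*} {s : Finset ι} {φ : ι → CNF} {z : ℕ → Bool} :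
    Satisfies (s.biUnion φ) z ↔ ∀ i ∈ s, (φ i).Satisfies z := by
  simp only [Satisfies, Finset.mem_biUnion]
  exact ⟨fun h i hi C hC => h C ⟨i, hi, hC⟩, fun h C ⟨i, hi, hC⟩ => h i hi C hC⟩

theorem size_union_le (φ ψ : CNF) : CNF.size (φ ∪ ψ) ≤ φ.size + ψ.size := by
  have h := Finset.sum_union_inter (s₁ := φ) (s₂ := ψ)
    (f := fun C : Finset (ℕ × Bool) => C.card + 1)
  unfold CNF.size
  lia

theorem size_biUnion_le {ι : Type*} (s : Finset ι) (φ : ι → CNF) :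
    CNF.size (s.biUnion φ) ≤ ∑ i ∈ s, (φ i).size := by
  classical
  induction s using Finset.induction_on with
  | empty => simp [CNF.size]
  | insert a s ha ih =>
    rw [Finset.biUnion_insert, Finset.sum_insert ha]
    exact (size_union_le _ _).trans (Nat.add_le_add_left ih _)

theorem size_image_le {ι : Type*} (s : Finset ι) (C : ι → Finset (ℕ × Bool)) :
    CNF.size (s.image C) ≤ ∑ i ∈ s, ((C i).card + 1) := by
  classical
  rw [← Finset.biUnion_singleton]
  exact (size_biUnion_le _ _).trans_eq (Finset.sum_congr rfl fun i _ => Finset.sum_singleton _ _)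

/-- The formula `φ` with its variables renamed by `e`. -/
def rename (e : ℕ → ℕ) (φ : CNF) : CNF :=
  φ.image fun C => C.image fun l => (e l.1, l.2)

theorem satisfies_rename {e : ℕ → ℕ} {φ : CNF} {z : ℕ → Bool} :
    (φ.rename e).Satisfies z ↔ φ.Satisfies (z ∘ e) := by
  simp [Satisfies, rename]

theorem size_rename_le (e : ℕ → ℕ) (φ : CNF) : (φ.rename e).size ≤ φ.size :=
  (size_image_le _ _).trans
    (Finset.sum_le_sum fun _ _ => Nat.succ_le_succ Finset.card_image_le)

/-- The clause in the variables `S` that is false exactly at the assignments whose set of true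
variables in `S` is `R`. -/
def blockingClause (S R : Finset ℕ) : Finset (ℕ × Bool) :=
  S.image fun v => (v, !decide (v ∈ R))

theorem exists_mem_blockingClause_iff {S R : Finset ℕ} {z : ℕ → Bool} :
    (∃ l ∈ blockingClause S R, z l.1 = l.2) ↔ ¬ ∀ v ∈ S, z v = decide (v ∈ R) := by
  simp [blockingClause, Bool.eq_not]

open Classical in
/-- The canonical CNF formula, in the variables `S`, of a predicate `P` that depends only on
these. -/
noncomputable def ofPred (S : Finset ℕ) (P : (ℕ → Bool) → Prop) : CNF :=
  (S.powerset.filter fun R => ¬ P fun v => decide (v ∈ R)).image (blockingClause S)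

theorem satisfies_ofPred {S : Finset ℕ} {P : (ℕ → Bool) → Prop} (hP : DependsOn P S)
    {z : ℕ → Bool} : (ofPred S P).Satisfies z ↔ P z := by
  have h : (ofPred S P).Satisfies z ↔
      ∀ R ⊆ S, (∀ v ∈ S, z v = decide (v ∈ R)) → P fun v => decide (v ∈ R) := by
    simp only [Satisfies, ofPred, Finset.forall_mem_image, Finset.mem_filter, Finset.mem_powerset,
      exists_mem_blockingClause_iff, and_imp, not_imp_not]
  rw [h]
  constructor
  · intro hz
    have hR : ∀ v ∈ S, z v = decide (v ∈ S.filter fun v => z v = true) := by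
      simp +contextual
    exact (hP hR).mpr (hz _ (Finset.filter_subset _ _) hR)
  · exact fun hz R _ hR => (hP hR).mp hz

theorem size_ofPred_le (S : Finset ℕ) (P : (ℕ → Bool) → Prop) :
    (ofPred S P).size ≤ 2 ^ S.card * (S.card + 1) := by
  classical
  calc (ofPred S P).size
      ≤ (S.powerset.filter fun R => ¬ P fun v => decide (v ∈ R)).card • (S.card + 1) :=
        (size_image_le _ _).trans
          (Finset.sum_le_card_nsmul _ _ _ fun _ _ => Nat.succ_le_succ Finset.card_image_le)
    _ ≤ 2 ^ S.card * (S.card + 1) := by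
        rw [smul_eq_mul, ← Finset.card_powerset]
        exact Nat.mul_le_mul_right _ (Finset.card_filter_le _ _)

theorem exists_satisfies_iff_of_dependsOn {ι : Type*} (I : Finset ι) {S : ι → Finset ℕ}
    {P : ι → (ℕ → Bool) → Prop} (hP : ∀ i ∈ I, DependsOn (P i) (S i)) {k : ℕ}
    (hS : ∀ i ∈ I, (S i).card ≤ k) :
    ∃ φ : CNF, φ.size ≤ I.card * (2 ^ k * (k + 1)) ∧ ∀ z, φ.Satisfies z ↔ ∀ i ∈ I, P i z := by
  refine ⟨I.biUnion fun i => ofPred (S i) (P i), ?_, fun z => ?_⟩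
  · refine (size_biUnion_le _ _).trans (Finset.sum_le_card_nsmul _ _ _ fun i hi => ?_)
    refine (size_ofPred_le _ _).trans ?_
    gcongr
    exacts [one_le_two, hS i hi, hS i hi]
  · rw [satisfies_biUnion]
    exact forall₂_congr fun i hi => satisfies_ofPred (hP i hi)

end CNF

/-! ### Computations as tableaux -/

theorem exists_run_of_reflGen_run {α : Type*} {r : α → α → Prop} {c : ℕ → α} {T : ℕ}
    (hc : ∀ i < T, Relation.ReflGen r (c i) (c (i + 1))) :
    ∃ t ≤ T, ∃ c' : ℕ → α, c' 0 = c 0 ∧ (∀ i < t, r (c' i) (c' (i + 1))) ∧ c' t = c T := by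
  induction T with
  | zero => exact ⟨0, le_rfl, c, rfl, by simp, rfl⟩
  | succ T ih =>
    obtain ⟨t, ht, c', h0, hr, hT⟩ := ih fun i hi => hc i (by lia)
    rcases (Relation.reflGen_iff _ _ _).1 (hc T T.lt_succ_self) with heq | hstep
    · exact ⟨t, by lia, c', h0, hr, hT.trans heq.symm⟩
    · refine ⟨t + 1, by lia, fun i => if i ≤ t then c' i else c (T + 1), by simpa using h0,
        fun i hi => ?_, by simp⟩
      rcases Nat.lt_succ_iff_lt_or_eq.1 hi with hi | rfl
      · simpa [hi.le, Nat.succ_le_of_lt hi] using hr i hi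
      · simpa [hT] using hstep

namespace NTM

variable {M : NTM}

theorem acceptsWithin_iff_exists_lazy_run {w : List Bool} {T : ℕ} :
    M.AcceptsWithin w T ↔ ∃ c : ℕ → M.Cfg, c 0 = M.init w ∧
      (∀ t < T, Relation.ReflGen M.Step (c t) (c (t + 1))) ∧ (c T).state = M.accept := by
  constructor
  · rintro ⟨t, c, htT, h0, hstep, hacc⟩
    refine ⟨fun i => c (min i t), by simpa using h0, fun i _ => ?_, by simpa [htT] using hacc⟩
    rcases lt_or_ge i t with hi | hi
    · simpa [hi.le, Nat.succ_le_of_lt hi] using .single (hstep i hi)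
    · simpa [hi, hi.trans i.le_succ] using .refl
  · rintro ⟨c, h0, hstep, hacc⟩
    obtain ⟨t, htT, c', h0', hstep', hT⟩ := exists_run_of_reflGen_run hstep
    exact ⟨t, c', htT, h0'.trans h0, hstep', by rwa [hT]⟩

/-- The displacement of the head in a move; `none` stands for an idle move. -/
def displacement : Option Turing.Dir → ℤ
  | none => 0
  | some .left => -1
  | some .right => 1

theorem abs_displacement_le (m : Option Turing.Dir) : |displacement m| ≤ 1 := by
  rcases m with _ | _ | _ <;> simp [displacement]

/-- `M.Allows q s q' a m`: in state `q` and reading `s`, the machine may pass to state `q'`, write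
`a` and make the move `m`. The idle move is always allowed, provided it changes nothing. -/
def Allows (M : NTM) (q : M.State) (s : M.Symbol) (q' : M.State) (a : M.Symbol) :
    Option Turing.Dir → Prop
  | none => q' = q ∧ a = s
  | some d => (q', a, d) ∈ M.trans q s

theorem reflGen_step_iff {c c' : M.Cfg} :
    Relation.ReflGen M.Step c c' ↔ ∃ (a : M.Symbol) (m : Option Turing.Dir),
      M.Allows c.state (c.tape c.pos) c'.state a m ∧
      c'.tape = Function.update c.tape c.pos a ∧ c'.pos = c.pos + displacement m := by
  rw [Relation.reflGen_iff]
  constructor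
  · rintro (rfl | ⟨_, a, d, hmem, rfl, htape, hpos⟩)
    · exact ⟨_, none, ⟨rfl, rfl⟩, by simp, by simp [displacement]⟩
    · exact ⟨a, some d, hmem, htape, by cases d <;> exact hpos⟩
  · rintro ⟨a, _ | d, hallows, htape, hpos⟩
    · left
      rw [Allows] at hallows
      obtain ⟨q, p, s⟩ := c'
      simp_all [displacement]
    · exact .inr ⟨_, a, d, hallows, rfl, htape, by cases d <;> exact hpos⟩

/-- The content of a cell of a tableau. A tableau has one row for each time, and the rows are
shifted so that the head is at place `0`. The action taken at that time is repeated in all cells of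
the row, although only the one at place `0` is ever consulted. -/
structure Cell (M : NTM) where
  state : M.State
  symbol : M.Symbol
  write : M.Symbol
  move : Option Turing.Dir

instance : Finite M.Cell := by
  have := M.finState
  have := M.finSymbol
  have : Finite Turing.Dir :=
    Finite.of_injective (fun d => d = Turing.Dir.left) (by rintro ⟨⟩ ⟨⟩ <;> simp)
  refine Finite.of_injective (fun c : M.Cell => (c.state, c.symbol, c.write, c.move)) ?_
  rintro ⟨⟩ ⟨⟩ h
  simpa using h

instance : Nonempty M.Cell :=
  ⟨⟨M.start, M.encode none, M.encode none, none⟩⟩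

/-- The condition at time `t` and place `i` for `D` to be the tableau of an accepting lazy
computation of length `T` on the tape `a`. -/
structure IsValidAt (T : ℕ) (a : ℤ → M.Symbol) (D : ℕ → ℤ → M.Cell) (t : ℕ) (i : ℤ) : Prop where
  initial : t = 0 → (D t 0).state = M.start ∧ (D t i).symbol = a i
  final : t = T → (D t 0).state = M.accept
  allows : t < T →
    M.Allows (D t 0).state (D t 0).symbol (D (t + 1) 0).state (D t 0).write (D t 0).move
  symbol_succ : t < T → (D (t + 1) i).symbol =
    if i + displacement (D t 0).move = 0 then (D t 0).write
    else (D t (i + displacement (D t 0).move)).symbol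

/-- The cells on which validity at time `t` and place `i` depends. -/
def neighbourhood (t : ℕ) (i : ℤ) : Finset (ℕ × ℤ) :=
  {(t, 0), (t, i), (t, i + -1), (t, i + 1), (t + 1, 0), (t + 1, i)}

theorem IsValidAt.congr {T t : ℕ} {i : ℤ} {a a' : ℤ → M.Symbol} {D D' : ℕ → ℤ → M.Cell}
    (ha : a i = a' i) (hD : ∀ p ∈ neighbourhood t i, D p.1 p.2 = D' p.1 p.2)
    (h : IsValidAt T a D t i) : IsValidAt T a' D' t i := by
  simp only [neighbourhood, Finset.forall_mem_insert, Finset.mem_singleton, forall_eq] at hD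
  obtain ⟨h0, hi, hl, hr, h0', hi'⟩ := hD
  have hd : ∀ m, D t (i + displacement m) = D' t (i + displacement m) := by
    rintro (_ | _ | _) <;> simpa [displacement]
  obtain ⟨hinitial, hfinal, hallows, hsymbol⟩ := h
  rw [h0, hi, ha] at hinitial
  rw [h0] at hfinal
  rw [h0, h0'] at hallows
  rw [h0, hi', hd] at hsymbol
  exact ⟨hinitial, hfinal, hallows, hsymbol⟩

/-- `D` is the tableau of an accepting lazy computation of length `T` on the tape `a`. Places
further than `T` from the head cannot influence the computation and are unconstrained. -/
def IsTableau (T : ℕ) (a : ℤ → M.Symbol) (D : ℕ → ℤ → M.Cell) : Prop :=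
  ∀ t ≤ T, ∀ i : ℤ, |i| ≤ T → IsValidAt T a D t i

/-- The sequence of configurations that takes its states and actions from the tableau `D`. -/
def follow (a : ℤ → M.Symbol) (D : ℕ → ℤ → M.Cell) : ℕ → M.Cfg
  | 0 => ⟨(D 0 0).state, 0, a⟩
  | t + 1 =>
    ⟨(D (t + 1) 0).state, (follow a D t).pos + displacement (D t 0).move,
      Function.update (follow a D t).tape (follow a D t).pos (D t 0).write⟩

theorem follow_state (a : ℤ → M.Symbol) (D : ℕ → ℤ → M.Cell) (t : ℕ) :
    (follow a D t).state = (D t 0).state := by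
  cases t <;> rfl

theorem update_apply_add_add {α : Type*} (s : ℤ → α) (p i d : ℤ) (a : α) :
    Function.update s p a (p + d + i) = if i + d = 0 then a else s (p + (i + d)) := by
  rw [Function.update_apply, add_assoc, add_comm d i]
  simp only [add_eq_left]

theorem IsTableau.follow_tape {T : ℕ} {a : ℤ → M.Symbol} {D : ℕ → ℤ → M.Cell}
    (hD : IsTableau T a D) (t : ℕ) (i : ℤ) (hi : |i| + t ≤ T) :
    (follow a D t).tape ((follow a D t).pos + i) = (D t i).symbol := by
  induction t generalizing i with
  | zero =>
    rw [((hD 0 T.zero_le i (by simpa using hi)).initial rfl).2]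
    simp [follow]
  | succ t ih =>
    push_cast at hi
    have hdist : |i + displacement (D t 0).move| + t ≤ T := by
      linarith [abs_add_le i (displacement (D t 0).move), abs_displacement_le (D t 0).move]
    have htT : t < T := by have := abs_nonneg i; lia
    rw [(hD t htT.le i (by lia)).symbol_succ htT, ← ih _ hdist]
    by_cases h : i + displacement (D t 0).move = 0 <;>
      simp [follow, update_apply_add_add, h]

theorem exists_isTableau_iff {T : ℕ} {a : ℤ → M.Symbol} :
    (∃ D : ℕ → ℤ → M.Cell, IsTableau T a D) ↔ ∃ c : ℕ → M.Cfg, c 0 = ⟨M.start, 0, a⟩ ∧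
      (∀ t < T, Relation.ReflGen M.Step (c t) (c (t + 1))) ∧ (c T).state = M.accept := by
  constructor
  · rintro ⟨D, hD⟩
    have hD0 : ∀ t ≤ T, IsValidAt T a D t 0 := fun t ht => hD t ht 0 (by simp)
    refine ⟨follow a D, ?_, fun t ht => ?_, ?_⟩
    · rw [follow, ((hD0 0 T.zero_le).initial rfl).1]
    · have hread := hD.follow_tape t 0 (by simpa using ht.le)
      rw [add_zero] at hread
      refine reflGen_step_iff.2 ⟨(D t 0).write, (D t 0).move, ?_, rfl, rfl⟩
      rw [hread, follow_state, follow_state]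
      exact (hD0 t ht.le).allows ht
    · rw [follow_state]
      exact (hD0 T le_rfl).final rfl
  · rintro ⟨c, h0, hstep, hacc⟩
    have haction : ∀ t, ∃ (b : M.Symbol) (m : Option Turing.Dir), t < T →
        M.Allows (c t).state ((c t).tape (c t).pos) (c (t + 1)).state b m ∧
        (c (t + 1)).tape = Function.update (c t).tape (c t).pos b ∧
        (c (t + 1)).pos = (c t).pos + displacement m := fun t => by
      by_cases ht : t < T
      · simpa only [ht, true_imp_iff] using reflGen_step_iff.1 (hstep t ht)
      · exact ⟨M.encode none, none, fun h => absurd h ht⟩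
    choose b m hbm using haction
    refine ⟨fun t i => ⟨(c t).state, (c t).tape ((c t).pos + i), b t, m t⟩,
      fun t _ i _ => ⟨?_, ?_, fun ht => ?_, fun ht => ?_⟩⟩
    · rintro rfl
      simp [h0]
    · rintro rfl
      exact hacc
    · simpa using (hbm t ht).1
    · simp only [(hbm t ht).2.1, (hbm t ht).2.2, update_apply_add_add]

theorem acceptsWithin_iff_exists_isTableau {w : List Bool} {T : ℕ} :
    M.AcceptsWithin w T ↔ ∃ D : ℕ → ℤ → M.Cell, IsTableau T (M.init w).tape D :=
  acceptsWithin_iff_exists_lazy_run.trans exists_isTableau_iff.symm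

end NTM

/-! ### The Cook–Levin theorem -/

/-- The set of words of length `n` that extend to a satisfying assignment of `φ`: the variables
`x₀, …, xₙ₋₁` hold the word, and all other variables are quantified existentially. -/
def CNF.projection (φ : CNF) (n : ℕ) : Set (Fin n → Bool) :=
  {x | ∃ z : ℕ → Bool, (∀ i : Fin n, z i = x i) ∧ φ.Satisfies z}

/-- The language `L` belongs to NP/poly. The nondeterministic circuits are encoded as CNF formulas
of polynomial size whose projections are the slices of `L`. -/
def IsNPPoly (L : Set (List Bool)) : Prop :=
  ∃ (φ : ℕ → CNF) (p : Polynomial ℕ), ∀ n,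
    (φ n).size ≤ p.eval n ∧ (φ n).projection n = {x | List.ofFn x ∈ L}

theorem exists_surjective_bool_pow (α : Type*) [Finite α] [Nonempty α] :
    ∃ (B : ℕ) (dec : (Fin B → Bool) → α), Function.Surjective dec := by
  classical
  obtain ⟨B, ⟨e⟩⟩ := Finite.exists_equiv_fin α
  have hinj : Function.Injective fun (a : α) (i : Fin B) => decide (e a = i) := fun a b h => by
    simpa using congrFun h (e b)
  exact ⟨B, _, Function.invFun_surjective hinj⟩

section TableauVariables

variable {α : Type*} {B : ℕ}

/-- The variable for bit `b` of the tableau cell at time `t` and place `i`; the first `n` variables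
are left to the input. -/
def cellVar (n t : ℕ) (i : ℤ) (b : Fin B) : ℕ :=
  n + Encodable.encode (t, i, b)

/-- The tableau described by the assignment `z`, where `dec` decodes the content of a cell. -/
def decodeTableau (n : ℕ) (dec : (Fin B → Bool) → α) (z : ℕ → Bool) (t : ℕ) (i : ℤ) : α :=
  dec fun b => z (cellVar n t i b)

theorem exists_decodeTableau_eq {n : ℕ} {dec : (Fin B → Bool) → α}
    (hdec : Function.Surjective dec) (x : Fin n → Bool) (D : ℕ → ℤ → α) :
    ∃ z : ℕ → Bool, (∀ i : Fin n, z i = x i) ∧ decodeTableau n dec z = D := by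
  choose enc henc using hdec
  let cellBit : ℕ × ℤ × Fin B → Bool := fun p => enc (D p.1 p.2.1) p.2.2
  refine ⟨fun v => if h : v < n then x ⟨v, h⟩ else (Encodable.decode (v - n)).elim false cellBit,
    fun i => by simp, ?_⟩
  funext t i
  simp only [decodeTableau, cellVar, not_lt.2 (Nat.le_add_right _ _), dif_neg, not_false_eq_true,
    Nat.add_sub_cancel_left, Encodable.encodek, Option.elim_some, cellBit, henc]

/-- The variables on which the validity of a decoded tableau at time `t` and place `i` depends. -/
def localVars (n B t : ℕ) (i : ℤ) : Finset ℕ :=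
  insert i.toNat <|
    (NTM.neighbourhood t i ×ˢ Finset.univ).image fun p : (ℕ × ℤ) × Fin B =>
      cellVar n p.1.1 p.1.2 p.2

theorem card_localVars_le (n B t : ℕ) (i : ℤ) : (localVars n B t i).card ≤ 6 * B + 1 := by
  refine (Finset.card_insert_le _ _).trans (Nat.succ_le_succ (Finset.card_image_le.trans ?_))
  rw [Finset.card_product, Finset.card_univ, Fintype.card_fin]
  exact Nat.mul_le_mul_right _ Finset.card_le_six

end TableauVariables

namespace NTM

variable {M : NTM}

theorem dependsOn_init_tape (n : ℕ) (i : ℤ) :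
    DependsOn (fun z : ℕ → Bool => (M.init (List.ofFn fun j : Fin n => z j)).tape i)
      {i.toNat} := by
  intro z z' h
  simp [init, List.getElem?_ofFn, h i.toNat rfl]

theorem dependsOn_isValidAt {B : ℕ} (n T : ℕ) (dec : (Fin B → Bool) → M.Cell) (t : ℕ) (i : ℤ) :
    DependsOn (fun z : ℕ → Bool => IsValidAt T (M.init (List.ofFn fun j : Fin n => z j)).tape
      (decodeTableau n dec z) t i) (localVars n B t i) := by
  have himp : ∀ z z' : ℕ → Bool, (∀ v ∈ localVars n B t i, z v = z' v) →
      IsValidAt T (M.init (List.ofFn fun j : Fin n => z j)).tape (decodeTableau n dec z) t i →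
      IsValidAt T (M.init (List.ofFn fun j : Fin n => z' j)).tape (decodeTableau n dec z') t i := by
    intro z z' h
    refine IsValidAt.congr (dependsOn_init_tape n i ?_) fun p hp => ?_
    · rintro _ rfl
      exact h _ (Finset.mem_insert_self _ _)
    · refine congrArg dec (funext fun b => h _ (Finset.mem_insert_of_mem ?_))
      exact Finset.mem_image_of_mem _ (Finset.mk_mem_product hp (Finset.mem_univ b))
  exact fun z z' h => propext ⟨himp z z' h, himp z' z fun v hv => (h v hv).symm⟩

/-- The times and places at which a tableau for `T` steps is constrained. -/
noncomputable def window (T : ℕ) : Finset (ℕ × ℤ) :=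
  Finset.range (T + 1) ×ˢ Finset.Icc (-T : ℤ) T

theorem card_window (T : ℕ) : (window T).card = (T + 1) * (2 * T + 1) := by
  rw [window, Finset.card_product, Finset.card_range, Int.card_Icc]
  congr 1
  lia

theorem isTableau_iff_forall_mem_window {T : ℕ} {a : ℤ → M.Symbol} {D : ℕ → ℤ → M.Cell} :
    IsTableau T a D ↔ ∀ q ∈ window T, IsValidAt T a D q.1 q.2 := by
  simp only [IsTableau, window, Prod.forall, Finset.mem_product, Finset.mem_range,
    Nat.lt_succ_iff, Finset.mem_Icc, abs_le]
  exact ⟨fun h t i hti => h t hti.1 i hti.2, fun h t ht i hi => h t i ⟨ht, hi⟩⟩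

theorem exists_projection_eq_acceptsWithin (M : NTM) :
    ∃ K : ℕ, ∀ n T : ℕ, ∃ φ : CNF, φ.size ≤ (T + 1) * (2 * T + 1) * K ∧
      φ.projection n = {x | M.AcceptsWithin (List.ofFn x) T} := by
  obtain ⟨B, dec, hdec⟩ := exists_surjective_bool_pow M.Cell
  refine ⟨2 ^ (6 * B + 1) * (6 * B + 1 + 1), fun n T => ?_⟩
  obtain ⟨φ, hsize, hφ⟩ := CNF.exists_satisfies_iff_of_dependsOn (window T)
    (fun q _ => dependsOn_isValidAt n T dec q.1 q.2) fun q _ => card_localVars_le n B q.1 q.2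
  simp only [← isTableau_iff_forall_mem_window] at hφ
  refine ⟨φ, by rwa [card_window] at hsize, Set.ext fun x => ?_⟩
  simp only [CNF.projection, Set.mem_ofPred_eq, hφ, acceptsWithin_iff_exists_isTableau]
  constructor
  · rintro ⟨z, hzx, hz⟩
    simp only [hzx] at hz
    exact ⟨_, hz⟩
  · rintro ⟨D, hD⟩
    obtain ⟨z, hzx, rfl⟩ := exists_decodeTableau_eq hdec x D
    exact ⟨z, hzx, by simpa only [hzx] using hD⟩

end NTM

theorem IsNP.isNPPoly {L : Set (List Bool)} (hL : IsNP L) : IsNPPoly L := by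
  obtain ⟨M, p, hM⟩ := hL
  obtain ⟨K, hK⟩ := M.exists_projection_eq_acceptsWithin
  choose φ hsize hφ using hK
  refine ⟨fun n => φ n (p.eval n), (p + 1) * (2 * p + 1) * Polynomial.C K, fun n => ⟨?_, ?_⟩⟩
  · simpa using hsize n (p.eval n)
  · simp only [hφ, hM, List.length_ofFn]

/-! ### Completeness of R(LIN) -/

/-- All members of the clause are linear polynomials. -/
def LinClause.IsLinear (C : LinClause) : Prop :=
  ∀ g ∈ C, g.totalDegree ≤ 1

theorem totalDegree_literalPoly_le (l : ℕ × Bool) : (literalPoly l).totalDegree ≤ 1 := by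
  unfold literalPoly
  split_ifs
  · exact (MvPolynomial.totalDegree_X _).le
  · exact (MvPolynomial.totalDegree_add _ _).trans (by simp)

theorem literalPoly_true_add_literalPoly_false (v : ℕ) :
    literalPoly (v, true) + literalPoly (v, false) + 1 = 0 := by
  have h2 : (2 : MvPolynomial ℕ (ZMod 2)) = 0 := CharTwo.two_eq_zero
  simp only [literalPoly, if_true, Bool.false_eq_true, if_false]
  linear_combination (MvPolynomial.X v + 1) * h2

theorem Contraction.isLinear {A C : LinClause} (h : Contraction A C) (hA : A.IsLinear) :
    C.IsLinear :=
  fun g hg => hA g (h ▸ Finset.mem_insert_of_mem hg)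

theorem Addition.isLinear {A B E : LinClause} (h : Addition A B E) (hA : A.IsLinear)
    (hB : B.IsLinear) : E.IsLinear := by
  obtain ⟨C, D, g, h, rfl, rfl, rfl⟩ := h
  simp only [LinClause.IsLinear, Finset.forall_mem_insert, Finset.forall_mem_union] at hA hB ⊢
  refine ⟨?_, hA.2, hB.2⟩
  exact (MvPolynomial.totalDegree_add _ _).trans <|
    max_le ((MvPolynomial.totalDegree_add _ _).trans (max_le hA.1 hB.1)) (by simp)

/-- The clause `C` is a clause of `φ` or follows from clauses in `S` by one of the rules. -/
def Infers (φ : CNF) (S : Set LinClause) (C : LinClause) : Prop :=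
  C ∈ linClauses φ ∨ (∃ A ∈ S, Contraction A C) ∨ ∃ A ∈ S, ∃ B ∈ S, Addition A B C

theorem Infers.mono {φ : CNF} {S S' : Set LinClause} {C : LinClause} (hS : S ⊆ S')
    (h : Infers φ S C) : Infers φ S' C :=
  h.imp_right <| Or.imp (fun ⟨A, hA, hc⟩ => ⟨A, hS hA, hc⟩)
    fun ⟨A, hA, B, hB, hc⟩ => ⟨A, hS hA, B, hS hB, hc⟩

theorem Infers.isLinear {φ : CNF} {S : Set LinClause} {C : LinClause} (h : Infers φ S C)
    (hS : ∀ A ∈ S, A.IsLinear) : C.IsLinear := by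
  rcases h with hC | ⟨A, hA, h⟩ | ⟨A, hA, B, hB, h⟩
  · obtain ⟨D, _, rfl⟩ := Finset.mem_image.1 hC
    exact Finset.forall_mem_image.2 fun l _ => totalDegree_literalPoly_le l
  · exact h.isLinear (hS A hA)
  · exact h.isLinear (hS A hA) (hS B hB)

/-- Each member of the list is a clause of `φ` or follows from earlier members by one of the rules.
In contrast to `Refutation`, neither linearity nor the last clause is prescribed. -/
def IsDerivation (φ : CNF) (L : List LinClause) : Prop :=
  ∀ (j : ℕ) (hj : j < L.length), Infers φ {A | A ∈ L.take j} L[j]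

namespace IsDerivation

variable {φ : CNF} {L L' : List LinClause}

theorem append (hL : IsDerivation φ L) (hL' : IsDerivation φ L') : IsDerivation φ (L ++ L') := by
  intro j hj
  rcases lt_or_ge j L.length with hlt | hge
  · rw [List.getElem_append_left hlt, List.take_append_of_le_length hlt.le]
    exact hL j hlt
  · rw [List.getElem_append_right hge, List.take_append, List.take_of_length_le hge]
    exact (hL' _ _).mono fun A hA => List.mem_append_right _ hA

theorem concat (hL : IsDerivation φ L) {C : LinClause} (hC : Infers φ {A | A ∈ L} C) :
    IsDerivation φ (L ++ [C]) := by
  intro j hj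
  rcases lt_or_ge j L.length with hlt | hge
  · rw [List.getElem_append_left hlt, List.take_append_of_le_length hlt.le]
    exact hL j hlt
  · obtain rfl : j = L.length := by
      rw [List.length_append, List.length_singleton] at hj
      lia
    simpa using hC

theorem isLinear (hL : IsDerivation φ L) (j : ℕ) (hj : j < L.length) : LinClause.IsLinear L[j] := by
  induction j using Nat.strong_induction_on with
  | _ j ih =>
    refine (hL j hj).isLinear fun A hA => ?_
    obtain ⟨i, hi, rfl⟩ := List.mem_take_iff_getElem.1 hA
    exact ih i (by lia) (by lia)

theorem nonempty_refutation (hL : IsDerivation φ L) (hempty : ∅ ∈ L) : Nonempty (Refutation φ) := by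
  obtain ⟨m, hm, hlast⟩ := List.mem_iff_getElem.1 hempty
  have hearlier : ∀ (j : Fin (m + 1)) (A : LinClause), A ∈ L.take j →
      ∃ i : Fin (m + 1), i < j ∧ L[i] = A := fun j A hA => by
    obtain ⟨i, hi, rfl⟩ := List.mem_take_iff_getElem.1 hA
    exact ⟨⟨i, by lia⟩, Fin.lt_def.2 (by dsimp only; lia), rfl⟩
  refine ⟨⟨m, fun j => L[j], fun j => hL.isLinear j (by lia), fun j => ?_, hlast⟩⟩
  refine (hL j (by lia)).imp_right (Or.imp ?_ ?_)
  · rintro ⟨A, hA, h⟩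
    obtain ⟨i, hi, rfl⟩ := hearlier j A hA
    exact ⟨i, hi, h⟩
  · rintro ⟨A, hA, B, hB, h⟩
    obtain ⟨i, hi, rfl⟩ := hearlier j A hA
    obtain ⟨k, hk, rfl⟩ := hearlier j B hB
    exact ⟨i, k, hi, hk, h⟩

end IsDerivation

/-- The clause `C` occurs in some derivation from `φ`. -/
def Derivable (φ : CNF) (C : LinClause) : Prop :=
  ∃ L, IsDerivation φ L ∧ C ∈ L

namespace Derivable

variable {φ : CNF}

theorem of_infers {L : List LinClause} {C : LinClause} (hL : IsDerivation φ L)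
    (hC : Infers φ {A | A ∈ L} C) : Derivable φ C :=
  ⟨L ++ [C], hL.concat hC, by simp⟩

theorem of_mem {C : LinClause} (hC : C ∈ linClauses φ) : Derivable φ C :=
  of_infers (L := []) (fun j hj => absurd hj j.not_lt_zero) (.inl hC)

theorem contraction {A C : LinClause} (hA : Derivable φ A) (h : Contraction A C) :
    Derivable φ C :=
  let ⟨_, hL, hAL⟩ := hA
  of_infers hL (.inr (.inl ⟨A, hAL, h⟩))

theorem addition {A B E : LinClause} (hA : Derivable φ A) (hB : Derivable φ B)
    (h : Addition A B E) : Derivable φ E :=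
  let ⟨_, hL, hAL⟩ := hA
  let ⟨_, hL', hBL'⟩ := hB
  of_infers (hL.append hL') <|
    .inr (.inr ⟨A, List.mem_append_left _ hAL, B, List.mem_append_right _ hBL', h⟩)

theorem resolve {C D : Finset (ℕ × Bool)} {v : ℕ}
    (hC : Derivable φ (C.image literalPoly)) (hD : Derivable φ (D.image literalPoly))
    (hvC : (v, true) ∈ C) (hvD : (v, false) ∈ D) :
    Derivable φ ((C.erase (v, true) ∪ D.erase (v, false)).image literalPoly) := by
  refine (hC.addition hD ⟨(C.erase (v, true)).image literalPoly,
    (D.erase (v, false)).image literalPoly, literalPoly (v, true), literalPoly (v, false), ?_, ?_,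
    rfl⟩).contraction ?_
  · rw [← Finset.image_insert, Finset.insert_erase hvC]
  · rw [← Finset.image_insert, Finset.insert_erase hvD]
  · rw [Contraction, literalPoly_true_add_literalPoly_false, Finset.image_union]

end Derivable

/-- The literals in the first `N` variables that are false under `z`. -/
def falseLiterals (N : ℕ) (z : ℕ → Bool) : Finset (ℕ × Bool) :=
  (Finset.range N).image fun v => (v, !z v)

theorem falseLiterals_succ_update (N : ℕ) (z : ℕ → Bool) (b : Bool) :
    falseLiterals (N + 1) (Function.update z N b) = insert (N, !b) (falseLiterals N z) := by
  rw [falseLiterals, Finset.range_add_one, Finset.image_insert, Function.update_self]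
  congr 1
  refine Finset.image_congr fun v hv => ?_
  have hne : v ≠ N := (Finset.mem_range.1 hv).ne
  simp only [Function.update_of_ne hne]

theorem exists_derivable_subset_falseLiterals {φ : CNF} {N : ℕ} {z : ℕ → Bool}
    (h : ∀ b, ∃ C ⊆ falseLiterals (N + 1) (Function.update z N b),
      Derivable φ (C.image literalPoly)) :
    ∃ C ⊆ falseLiterals N z, Derivable φ (C.image literalPoly) := by
  simp only [falseLiterals_succ_update] at h
  obtain ⟨C, hCsub, hC⟩ := h false
  obtain ⟨D, hDsub, hD⟩ := h true
  by_cases hNC : (N, true) ∈ C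
  · by_cases hND : (N, false) ∈ D
    · exact ⟨_, Finset.union_subset (Finset.subset_insert_iff.1 hCsub)
        (Finset.subset_insert_iff.1 hDsub), hC.resolve hD hNC hND⟩
    · exact ⟨D, (Finset.subset_insert_iff_of_notMem hND).1 hDsub, hD⟩
  · exact ⟨C, (Finset.subset_insert_iff_of_notMem hNC).1 hCsub, hC⟩

theorem exists_mem_subset_falseLiterals {φ : CNF} {z : ℕ → Bool} (hz : ¬ φ.Satisfies z) :
    ∃ C ∈ φ, C ⊆ falseLiterals (φ.sup (fun C => C.sup Prod.fst) + 1) z := by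
  simp only [CNF.Satisfies, not_forall, not_exists, not_and] at hz
  obtain ⟨C, hC, hzC⟩ := hz
  refine ⟨C, hC, fun l hl => Finset.mem_image.2 ⟨l.1, Finset.mem_range_succ_iff.2 ?_, ?_⟩⟩
  · exact (Finset.le_sup (f := Prod.fst) hl).trans
      (Finset.le_sup (f := fun C : Finset (ℕ × Bool) => C.sup Prod.fst) hC)
  · exact Prod.ext rfl (Bool.not_eq.2 (hzC l hl))

theorem derivable_empty_of_unsatisfiable {φ : CNF} (hφ : ∀ z, ¬ φ.Satisfies z) :
    Derivable φ ∅ := by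
  have hdescent : ∀ N : ℕ,
      (∀ z, ∃ C ⊆ falseLiterals N z, Derivable φ (C.image literalPoly)) → Derivable φ ∅ := by
    intro N
    induction N with
    | zero =>
      intro h
      obtain ⟨C, hsub, hC⟩ := h fun _ => true
      rwa [Finset.subset_empty.1 hsub, Finset.image_empty] at hC
    | succ N ih => exact fun h => ih fun z => exists_derivable_subset_falseLiterals fun b => h _
  refine hdescent (φ.sup (fun C => C.sup Prod.fst) + 1) fun z => ?_
  obtain ⟨C, hC, hsub⟩ := exists_mem_subset_falseLiterals (hφ z)
  exact ⟨C, hsub, .of_mem (Finset.mem_image_of_mem _ hC)⟩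

theorem nonempty_refutation_of_unsatisfiable {φ : CNF} (hφ : ∀ z, ¬ φ.Satisfies z) :
    Nonempty (Refutation φ) :=
  let ⟨_, hL, hempty⟩ := derivable_empty_of_unsatisfiable hφ
  hL.nonempty_refutation hempty

/-! ### Protocols on directed acyclic graphs -/

namespace Protocol

section OfReachable

variable {n d : ℕ} {V : Type} [Fintype V] {children : V → Finset V}

open Classical in
/-- The protocol on the vertices of a finite directed acyclic graph that can be reached from
`source`. The other vertices are removed because a protocol has a single vertex of in-degree
zero. -/
noncomputable def ofReachable (source : V)
    (hacyclic : ∀ v, ¬ Relation.TransGen (fun u w => w ∈ children u) v v)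
    (hdegree : ∀ v, (children v).card ≤ d) (F : (Fin n → Bool) → (Fin n → Bool) → V → Prop)
    (hsink : ∀ v, children v = ∅ → ∃ i : Fin n, ∀ x y, F x y v ↔ (x i = false ∧ y i = true)) :
    Protocol n d where
  V := {v // Relation.ReflTransGen (fun u w => w ∈ children u) source v}
  fintypeV := inferInstance
  children v := (children v).subtype _
  acyclic v hv := hacyclic v (hv.lift Subtype.val fun _ _ => Finset.mem_subtype.1)
  source := ⟨source, .refl⟩
  eq_source_iff v := by
    simp only [Finset.mem_subtype, Subtype.forall]
    refine ⟨?_, fun h => ?_⟩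
    · rintro rfl u hu hmem
      exact hacyclic source (Relation.TransGen.tail' hu hmem)
    · rcases v.2.cases_tail with heq | ⟨u, hu, hmem⟩
      · exact Subtype.ext heq
      · exact absurd hmem (h u hu)
  degree_le v := (Finset.card_subtype _ _).trans_le ((Finset.card_filter_le _ _).trans (hdegree v))
  F x y v := F x y v
  sink v hv := hsink v <| Finset.eq_empty_of_forall_notMem fun w hw =>
    Finset.eq_empty_iff_forall_notMem.1 hv ⟨w, v.2.tail hw⟩ (Finset.mem_subtype.2 hw)

variable {source : V} {hacyclic : ∀ v, ¬ Relation.TransGen (fun u w => w ∈ children u) v v}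
  {hdegree : ∀ v, (children v).card ≤ d} {F : (Fin n → Bool) → (Fin n → Bool) → V → Prop}
  {hsink : ∀ v, children v = ∅ → ∃ i : Fin n, ∀ x y, F x y v ↔ (x i = false ∧ y i = true)}

theorem size_ofReachable_le :
    (ofReachable source hacyclic hdegree F hsink).size ≤ Fintype.card V := by
  classical
  exact Fintype.card_subtype_le _

theorem withEquality_ofReachable
    (h : ∀ v, ∃ q r : (Fin n → Bool) → ℝ, ∀ x y, F x y v ↔ q x = r y) :
    (ofReachable source hacyclic hdegree F hsink).WithEquality :=
  fun v => h v.1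

theorem solves_ofReachable {f : (Fin n → Bool) →. Bool}
    (h : ∀ x y, false ∈ f x → true ∈ f y →
      F x y source ∧ ∀ v, (children v).Nonempty → F x y v → ∃ u ∈ children v, F x y u) :
    (ofReachable source hacyclic hdegree F hsink).Solves f := by
  classical
  intro x y hx hy
  obtain ⟨hsource, hchild⟩ := h x y hx hy
  refine ⟨hsource, fun v ⟨u, hu⟩ hFv => ?_⟩
  obtain ⟨w, hw, hFw⟩ := hchild v.1 ⟨u.1, Finset.mem_subtype.1 hu⟩ hFv
  exact ⟨⟨w, v.2.tail hw⟩, Finset.mem_subtype.2 hw, hFw⟩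

end OfReachable

end Protocol

/-! ### Falsified clauses -/

/-- The clause `C`, read as the disjunction of the equations `g = 1` for `g ∈ C` over `𝔽₂`, is
false at the point `a`. -/
def Falsified {σ R : Type*} [CommSemiring R] (C : Finset (MvPolynomial σ R)) (a : σ → R) : Prop :=
  ∀ g ∈ C, MvPolynomial.eval a g = 0

/-- The assignment `z` as a point over `𝔽₂`. -/
def point (z : ℕ → Bool) (v : ℕ) : ZMod 2 :=
  if z v then 1 else 0

theorem eval_literalPoly_eq_zero (z : ℕ → Bool) (l : ℕ × Bool) :
    MvPolynomial.eval (point z) (literalPoly l) = 0 ↔ z l.1 ≠ l.2 := by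
  have h2 : (1 + 1 : ZMod 2) = 0 := CharTwo.add_self_eq_zero 1
  rcases l with ⟨v, b⟩
  cases b <;> cases h : z v <;> simp [literalPoly, point, h, h2]

theorem falsified_image_literalPoly {D : Finset (ℕ × Bool)} {z : ℕ → Bool} :
    Falsified (D.image literalPoly) (point z) ↔ ∀ l ∈ D, z l.1 ≠ l.2 := by
  simp only [Falsified, Finset.forall_mem_image, eval_literalPoly_eq_zero]

theorem Contraction.falsified {A C : LinClause} (h : Contraction A C) {a : ℕ → ZMod 2}
    (hC : Falsified C a) : Falsified A a := by
  rw [h]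
  exact (Finset.forall_mem_insert _ _ _).2 ⟨map_zero _, hC⟩

theorem Addition.falsified {A B E : LinClause} (h : Addition A B E) {a : ℕ → ZMod 2}
    (hE : Falsified E a) : Falsified A a ∨ Falsified B a := by
  obtain ⟨C, D, g, h, rfl, rfl, rfl⟩ := h
  simp only [Falsified, Finset.forall_mem_insert, Finset.forall_mem_union, map_add, map_one]
    at hE ⊢
  obtain ⟨hgh, hC, hD⟩ := hE
  have hzero : ∀ s t : ZMod 2, s + t + 1 = 0 → s = 0 ∨ t = 0 := by decide
  exact (hzero _ _ hgh).imp (⟨·, hC⟩) (⟨·, hD⟩)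

theorem eval_add_add_eval_zero {σ R : Type*} [CommSemiring R] {g : MvPolynomial σ R}
    (hg : g.totalDegree ≤ 1) (a b : σ → R) :
    MvPolynomial.eval (a + b) g + MvPolynomial.eval 0 g =
      MvPolynomial.eval a g + MvPolynomial.eval b g := by
  simp only [MvPolynomial.eval_eq, ← Finset.sum_add_distrib, ← mul_add]
  refine Finset.sum_congr rfl fun m hm => congrArg _ ?_
  have hdeg : m.degree ≤ 1 := (MvPolynomial.le_totalDegree hm).trans hg
  rcases Nat.le_one_iff_eq_zero_or_eq_one.1 hdeg with h0 | h1
  · rw [Finsupp.degree_eq_zero_iff] at h0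
    simp [h0]
  · obtain ⟨i, rfl⟩ := (Finsupp.sum_eq_one_iff m).1 h1
    classical simp

theorem exists_falsified_add_iff_eq {σ R X Y : Type*} [CommRing R] [Countable R]
    {C : Finset (MvPolynomial σ R)} (hC : ∀ g ∈ C, g.totalDegree ≤ 1) (a : X → σ → R)
    (b : Y → σ → R) :
    ∃ (q : X → ℝ) (r : Y → ℝ), ∀ x y, Falsified C (a x + b y) ↔ q x = r y := by
  obtain ⟨e, he⟩ := Countable.exists_injective_nat (C → R)
  refine ⟨fun x => e fun g => MvPolynomial.eval (a x) g.1,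
    fun y => e fun g => MvPolynomial.eval 0 g.1 - MvPolynomial.eval (b y) g.1, fun x y => ?_⟩
  rw [Nat.cast_inj, he.eq_iff, funext_iff, Subtype.forall]
  refine forall₂_congr fun g hg => ?_
  rw [eq_sub_iff_add_eq, ← eval_add_add_eval_zero (hC g hg), add_eq_right]

theorem exists_and_iff_eq {X Y : Type*} (p : X → Prop) (p' : Y → Prop) :
    ∃ (q : X → ℝ) (r : Y → ℝ), ∀ x y, (p x ∧ p' y) ↔ q x = r y := by
  classical
  refine ⟨fun x => if p x then 1 else 0, fun y => if p' y then 1 else 2, fun x y => ?_⟩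
  by_cases hx : p x <;> by_cases hy : p' y <;> simp [hx, hy]

/-! ### From refutations to protocols -/

namespace Refutation

variable {φ : CNF} (π : Refutation φ)

theorem exists_premises (j : Fin (π.len + 1)) :
    ∃ s : Finset (Fin (π.len + 1)), (∀ i ∈ s, i < j) ∧ s.card ≤ 2 ∧
      (s = ∅ → π.line j ∈ linClauses φ) ∧
      (s.Nonempty → ∀ a, Falsified (π.line j) a → ∃ i ∈ s, Falsified (π.line i) a) := by
  rcases π.derived j with hj | ⟨i, hi, h⟩ | ⟨i, k, hi, hk, h⟩
  · exact ⟨∅, by simp, by simp, fun _ => hj, fun h => absurd h Finset.not_nonempty_empty⟩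
  · exact ⟨{i}, by simpa using hi, by simp, fun h => absurd h (Finset.singleton_ne_empty i),
      fun _ a ha => ⟨i, by simp, h.falsified ha⟩⟩
  · exact ⟨{i, k}, by simp [hi, hk], Finset.card_le_two,
      fun h => absurd h (Finset.insert_ne_empty _ _), fun _ a ha => by simpa using h.falsified ha⟩

theorem exists_protocol {n : ℕ} {f : (Fin n → Bool) →. Bool}
    (a b : (Fin n → Bool) → ℕ → ZMod 2)
    (h : ∀ C ∈ linClauses φ, ∃ i : Fin n, ∀ x y, false ∈ f x → true ∈ f y →
      Falsified C (a x + b y) → x i = false ∧ y i = true) :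
    ∃ P : Protocol n 2, P.WithEquality ∧ P.Solves f ∧ P.size ≤ π.numLines := by
  choose premises hlt hcard hinitial hpremises using π.exists_premises
  have hacyclic : ∀ v, ¬ Relation.TransGen (fun u w => w ∈ premises u) v v := fun v hv =>
    lt_irrefl v <| Relation.transGen_minimal (r' := (· > ·)) (fun u w => hlt u w) v v hv
  have hF : ∀ j, ∃ F : (Fin n → Bool) → (Fin n → Bool) → Prop,
      (∃ q r : (Fin n → Bool) → ℝ, ∀ x y, F x y ↔ q x = r y) ∧
      (premises j = ∅ → ∃ i : Fin n, ∀ x y, F x y ↔ (x i = false ∧ y i = true)) ∧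
      (∀ x y, false ∈ f x → true ∈ f y → Falsified (π.line j) (a x + b y) → F x y) ∧
      ((premises j).Nonempty → ∀ x y, F x y → Falsified (π.line j) (a x + b y)) := by
    intro j
    rcases (premises j).eq_empty_or_nonempty with hj | hj
    · obtain ⟨i, hi⟩ := h _ (hinitial j hj)
      exact ⟨fun x y => x i = false ∧ y i = true,
        exists_and_iff_eq (fun x : Fin n → Bool => x i = false) fun y : Fin n → Bool => y i = true,
        fun _ => ⟨i, fun _ _ => Iff.rfl⟩, hi, fun hne => absurd hj hne.ne_empty⟩
    · exact ⟨fun x y => Falsified (π.line j) (a x + b y),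
        exists_falsified_add_iff_eq (π.linear j) a b, fun hempty => absurd hempty hj.ne_empty,
        fun _ _ _ _ => id, fun _ _ _ => id⟩
  choose F hequality hsink hfalsified hF using hF
  refine ⟨.ofReachable (Fin.last π.len) hacyclic hcard (fun x y j => F j x y) hsink,
    Protocol.withEquality_ofReachable hequality,
    Protocol.solves_ofReachable fun x y hx hy => ⟨?_, fun j hj hFj => ?_⟩,
    Protocol.size_ofReachable_le.trans_eq (Fintype.card_fin _)⟩
  · refine hfalsified _ x y hx hy ?_
    simp [π.last_empty, Falsified]
  · obtain ⟨i, hi, hfal⟩ := hpremises j hj _ (hF j hj x y hFj)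
    exact ⟨i, hi, hfalsified i x y hx hy hfal⟩

end Refutation

/-! ### Interpolation -/

/-- The assignment given by `s` on the variables `natSumNatEquivNat (.inl v)` and by `t` on the
variables `natSumNatEquivNat (.inr v)`. -/
def interleave (s t : ℕ → Bool) (v : ℕ) : Bool :=
  Sum.elim s t (Equiv.natSumNatEquivNat.symm v)

theorem interleave_comp_inl (s t : ℕ → Bool) :
    interleave s t ∘ (fun v => Equiv.natSumNatEquivNat (.inl v)) = s := by
  funext v
  rw [Function.comp_apply, interleave, Equiv.symm_apply_apply, Sum.elim_inl]

theorem interleave_comp_inr (s t : ℕ → Bool) :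
    interleave s t ∘ (fun v => Equiv.natSumNatEquivNat (.inr v)) = t := by
  funext v
  rw [Function.comp_apply, interleave, Equiv.symm_apply_apply, Sum.elim_inr]

theorem point_interleave (s t : ℕ → Bool) :
    point (interleave s t) = point (interleave s ⊥) + point (interleave ⊥ t) := by
  funext v
  rcases h : Equiv.natSumNatEquivNat.symm v with u | u <;>
    simp [point, interleave, h]

/-- The formula `φ(x, z) ∧ ψ(y, w) ∧ ⋀ᵢ (yᵢ → xᵢ)`, where `i < n`. The variables of `φ` and `ψ` are
made disjoint by `Equiv.natSumNatEquivNat`, and `xᵢ` and `yᵢ` are their copies of the variable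
`i`. -/
def interpolationCNF (n : ℕ) (φ ψ : CNF) : CNF :=
  φ.rename (fun v => Equiv.natSumNatEquivNat (.inl v)) ∪
    ψ.rename (fun v => Equiv.natSumNatEquivNat (.inr v)) ∪
    Finset.univ.image fun i : Fin n =>
      {(Equiv.natSumNatEquivNat (.inl i), true), (Equiv.natSumNatEquivNat (.inr i), false)}

theorem size_interpolationCNF_le (n : ℕ) (φ ψ : CNF) :
    (interpolationCNF n φ ψ).size ≤ φ.size + ψ.size + n * 3 := by
  refine (CNF.size_union_le _ _).trans (add_le_add ((CNF.size_union_le _ _).trans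
    (add_le_add (CNF.size_rename_le _ _) (CNF.size_rename_le _ _))) ?_)
  refine (CNF.size_image_le _ _).trans ((Finset.sum_le_card_nsmul _ _ 3
    fun i _ => Nat.succ_le_succ Finset.card_le_two).trans_eq ?_)
  rw [Finset.card_fin, smul_eq_mul]

section Interpolation

variable {n : ℕ} {φ ψ : CNF}

theorem le_of_satisfies_interpolationCNF {z : ℕ → Bool} (hz : (interpolationCNF n φ ψ).Satisfies z)
    (i : Fin n) : z (Equiv.natSumNatEquivNat (.inr i)) ≤ z (Equiv.natSumNatEquivNat (.inl i)) := by
  obtain ⟨l, hl, hzl⟩ :=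
    (CNF.satisfies_union.1 hz).2 _ (Finset.mem_image_of_mem _ (Finset.mem_univ i))
  rcases Finset.mem_insert.1 hl with rfl | hl
  · exact hzl ▸ Bool.le_true _
  · obtain rfl := Finset.mem_singleton.1 hl
    exact hzl ▸ Bool.false_le _

theorem not_satisfies_interpolationCNF {f : (Fin n → Bool) →. Bool} (hf : IsMonotone f)
    (hφ : φ.projection n ⊆ {x | false ∈ f x}) (hψ : ψ.projection n ⊆ {y | true ∈ f y})
    (z : ℕ → Bool) : ¬ (interpolationCNF n φ ψ).Satisfies z := by
  intro hz
  obtain ⟨hzφ, hzψ⟩ := CNF.satisfies_union.1 (CNF.satisfies_union.1 hz).1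
  have hx := hφ ⟨_, fun _ => rfl, CNF.satisfies_rename.1 hzφ⟩
  have hy := hψ ⟨_, fun _ => rfl, CNF.satisfies_rename.1 hzψ⟩
  exact absurd (hf _ _ (le_of_satisfies_interpolationCNF hz) _ hy _ hx) (by decide)

theorem exists_index_of_falsified (hn : 1 ≤ n) {C : LinClause}
    (hC : C ∈ linClauses (interpolationCNF n φ ψ)) :
    ∃ i : Fin n, ∀ s t, φ.Satisfies s → ψ.Satisfies t → Falsified C (point (interleave s t)) →
      s i = false ∧ t i = true := by
  obtain ⟨D, hD, rfl⟩ := Finset.mem_image.1 hC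
  simp only [falsified_image_literalPoly]
  simp only [interpolationCNF, Finset.mem_union] at hD
  rcases hD with (hD | hD) | hD
  · refine ⟨⟨0, hn⟩, fun s t hs _ hfal => ?_⟩
    rw [← interleave_comp_inl s t, ← CNF.satisfies_rename] at hs
    obtain ⟨l, hl, hsat⟩ := hs D hD
    exact absurd hsat (hfal l hl)
  · refine ⟨⟨0, hn⟩, fun s t _ ht hfal => ?_⟩
    rw [← interleave_comp_inr s t, ← CNF.satisfies_rename] at ht
    obtain ⟨l, hl, hsat⟩ := ht D hD
    exact absurd hsat (hfal l hl)
  · obtain ⟨i, -, rfl⟩ := Finset.mem_image.1 hD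
    refine ⟨i, fun s t _ _ hfal => ?_⟩
    simpa [interleave] using hfal

theorem Refutation.exists_protocol_of_interpolationCNF (hn : 1 ≤ n) {f : (Fin n → Bool) →. Bool}
    (hφ : {x | false ∈ f x} ⊆ φ.projection n) (hψ : {y | true ∈ f y} ⊆ ψ.projection n)
    (π : Refutation (interpolationCNF n φ ψ)) :
    ∃ P : Protocol n 2, P.WithEquality ∧ P.Solves f ∧ P.size ≤ π.numLines := by
  have hs : ∀ x, false ∈ f x → ∃ s : ℕ → Bool, (∀ i : Fin n, s i = x i) ∧ φ.Satisfies s := hφ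
  have ht : ∀ y, true ∈ f y → ∃ t : ℕ → Bool, (∀ i : Fin n, t i = y i) ∧ ψ.Satisfies t := hψ
  choose! s hsx hsφ using hs
  choose! t hty htψ using ht
  refine π.exists_protocol (fun x => point (interleave (s x) ⊥))
    (fun y => point (interleave ⊥ (t y))) fun C hC => ?_
  obtain ⟨i, hi⟩ := exists_index_of_falsified hn hC
  refine ⟨i, fun x y hx hy hfal => ?_⟩
  rw [← point_interleave] at hfal
  rw [← hsx x hx, ← hty y hy]
  exact hi _ _ (hsφ x hx) (htψ y hy) hfal

theorem exists_isLeast_equalityProtocolSizes_le (hn : 1 ≤ n) {f : (Fin n → Bool) →. Bool}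
    (hf : IsMonotone f) (hφ : φ.projection n = {x | false ∈ f x})
    (hψ : ψ.projection n = {y | true ∈ f y}) :
    ∃ s m, IsLeast (equalityProtocolSizes f) s ∧
      IsLeast (refutationLengths (interpolationCNF n φ ψ)) m ∧ s ≤ m := by
  obtain ⟨π₀⟩ := nonempty_refutation_of_unsatisfiable
    (not_satisfies_interpolationCNF hf hφ.subset hψ.subset)
  have hm : IsLeast (refutationLengths (interpolationCNF n φ ψ)) _ :=
    isLeast_csInf ⟨_, π₀, rfl⟩
  obtain ⟨π, hπ⟩ := hm.1
  obtain ⟨P, hequality, hsolves, hsize⟩ :=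
    π.exists_protocol_of_interpolationCNF hn hφ.superset hψ.superset
  have hP : P.size ∈ equalityProtocolSizes f := ⟨P, hequality, hsolves, rfl⟩
  have hs := isLeast_csInf ⟨_, hP⟩
  exact ⟨_, _, hs, hm, (hs.2 hP).trans (hsize.trans_eq hπ)⟩

end Interpolation

theorem setOf_ofFn_mem_preimage (f : List Bool →. Bool) (n : ℕ) (b : Bool) :
    {x : Fin n → Bool | List.ofFn x ∈ f.preimage {b}} = {x | b ∈ restrict f n x} := by
  ext x
  simp [restrict, PFun.mem_preimage]

theorem exists_eval_le_mul_pow (p : Polynomial ℕ) :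
    ∃ c k : ℕ, ∀ n, 1 ≤ n → p.eval n ≤ c * n ^ k := by
  refine ⟨p.eval 1, p.natDegree, fun n hn => ?_⟩
  rw [Polynomial.eval_eq_sum_range, Polynomial.eval_eq_sum_range, Finset.sum_mul]
  refine Finset.sum_le_sum fun i hi => ?_
  rw [one_pow, mul_one]
  gcongr
  exact Finset.mem_range_succ_iff.1 hi

end RLin

theorem mainTheorem4_general (f : List Bool →. Bool)
    (hmono : ∀ n, RLin.IsMonotone (RLin.restrict f n))
    (hU : RLin.IsNPPoly (f.preimage {false}))
    (hV : RLin.IsNPPoly (f.preimage {true})) :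
    ∃ (α : ℕ → RLin.CNF) (c k : ℕ), ∀ n : ℕ, 1 ≤ n →
      (α n).size ≤ c * n ^ k ∧
      ∃ s m : ℕ,
        IsLeast (RLin.equalityProtocolSizes (RLin.restrict f n)) s ∧
        IsLeast (RLin.refutationLengths (α n)) m ∧
        s ≤ m := by
  obtain ⟨φ, p, hφ⟩ := hU
  obtain ⟨ψ, q, hψ⟩ := hV
  simp only [RLin.setOf_ofFn_mem_preimage] at hφ hψ
  obtain ⟨c, k, hck⟩ := RLin.exists_eval_le_mul_pow (p + q + Polynomial.X * 3)
  refine ⟨fun n => RLin.interpolationCNF n (φ n) (ψ n), c, k, fun n hn => ⟨?_, ?_⟩⟩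
  · calc (RLin.interpolationCNF n (φ n) (ψ n)).size
      _ ≤ (φ n).size + (ψ n).size + n * 3 := RLin.size_interpolationCNF_le _ _ _
      _ ≤ p.eval n + q.eval n + n * 3 := by gcongr; exacts [(hφ n).1, (hψ n).1]
      _ = (p + q + Polynomial.X * 3).eval n := by simp
      _ ≤ c * n ^ k := hck n hn
  · exact RLin.exists_isLeast_equalityProtocolSizes_le hn (hmono n) (hφ n).2 (hψ n).2

theorem mainTheorem4 (f : List Bool →. Bool)
    (hmono : ∀ n, RLin.IsMonotone (RLin.restrict f n))
    (hU : RLin.IsNP (f.preimage {false}))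
    (hV : RLin.IsNP (f.preimage {true})) :
    ∃ (α : ℕ → RLin.CNF) (c k : ℕ), ∀ n : ℕ, 1 ≤ n →
      (α n).size ≤ c * n ^ k ∧
      ∃ s m : ℕ,
        IsLeast (RLin.equalityProtocolSizes (RLin.restrict f n)) s ∧
        IsLeast (RLin.refutationLengths (α n)) m ∧
        s ≤ m :=
  mainTheorem4_general f hmono hU.isNPPoly hV.isNPPoly
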